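/- Let $Y$ be a complex normed space (not assumed complete), let $N \subset Y$ be a finite-dimensional linear subspace, and let $f, h, k : Y \to Y$ be bounded linear operators. Suppose that $h \neq \lambda\,\mathrm{Id}$ for every $\lambda \in \mathbf{C}$, and that $k$ is nonzero and compact, i.e. $k$ maps every bounded set into a compact subset of $Y$. Suppose also that 1. $fh = hf$, 2. $(hk - kh)(x) \in N$ for every $x \in Y$, 3. $h(N) \subset N$. Then there is a nontrivial closed $f$-invariant subspace of $Y$: a closed linear subspace $M \subset Y$ with $M \neq \{0\}$, $M \neq Y$ and $f(M) \subset M$. -/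

import Mathlib

/-! If `N ≠ ⊥`, then `h` has an eigenvalue on `N`, and the corresponding eigenspace in `Y` is
closed, proper since `h` is not scalar, and invariant under `f` since `f` commutes with `h`. If `N =
⊥`, then `h` and `k` commute. Were there no invariant subspace, every nonzero orbit of the commutant
of `h` would be dense, as its closure is `f`-invariant. Lomonosov's lemma then yields `T` in the
commutant such that `T ∘L k` has a nonzero fixed vector; the fixed space is finite-dimensional by
compactness and `h`-invariant, so the first case applies. The lemma rests on Schauder's theorem,
derived from Brouwer's. Completeness is avoided by asking only that the range lie in a compact set,
not that convex hulls be relatively compact. -/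

/-! ### Brouwer's fixed point theorem -/

open Polynomial in
theorem ContinuousLinearMap.exists_polynomial_eval_eq_det_one_add_smul {E : Type*}
    [NormedAddCommGroup E] [NormedSpace ℝ E] [FiniteDimensional ℝ E] (W : E →L[ℝ] E) :
    ∃ p : ℝ[X], p.natDegree ≤ Module.finrank ℝ E ∧ ∀ t : ℝ, p.eval t = (1 + t • W).det := by
  let b := Module.finBasis ℝ E
  let A := LinearMap.toMatrix b b (W : E →ₗ[ℝ] E)
  refine ⟨((X : ℝ[X]) • A.map C + (1 : Matrix _ _ ℝ).map C).det, ?_, fun t ↦ ?_⟩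
  · simpa using natDegree_det_X_add_C_le A 1
  · rw [ContinuousLinearMap.det, ← LinearMap.det_toMatrix b, ← coe_evalRingHom, RingHom.map_det]
    congr 1
    ext i j
    simp [A, Matrix.one_apply, LinearMap.toMatrix_apply, Finsupp.single_apply, add_comm, eq_comm,
      apply_ite]
    exact mul_comm _ _

-- The coefficients do not depend on `p`, so the identity can be applied pointwise to a family of
-- polynomials and then integrated.
open Polynomial in
theorem Polynomial.exists_eval_eq_sum_mul_eval (n : ℕ) (v : Fin (n + 1) → ℝ)
    (hv : Function.Injective v) (x : ℝ) :
    ∃ c : Fin (n + 1) → ℝ, ∀ p : ℝ[X], p.natDegree ≤ n → p.eval x = ∑ i, c i * p.eval (v i) := by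
  refine ⟨fun i ↦ (Lagrange.basis Finset.univ v i).eval x, fun p hp ↦ ?_⟩
  conv_lhs => rw [Lagrange.eq_interpolate (f := p) (s := Finset.univ) (v := v) hv.injOn
    (degree_le_natDegree.trans_lt (by
      simp only [Finset.card_univ, Fintype.card_fin]
      exact_mod_cast Nat.lt_succ_of_le hp))]
  simp [Lagrange.interpolate_apply, eval_finsetSum, mul_comm]

open MeasureTheory Metric Set in
/-- Milnor and Rogers' volume argument: there is no `C¹` retraction of a ball onto its sphere. -/
theorem not_exists_contDiff_retraction_sphere {E : Type*} [NormedAddCommGroup E]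
    [InnerProductSpace ℝ E] [FiniteDimensional ℝ E] [MeasurableSpace E] [BorelSpace E]
    {F : E → E} (hF : ContDiff ℝ 1 F) {ρ : ℝ} (hρ : 0 < ρ) (hnorm : ∀ x, ‖F x‖ = ρ)
    (hid : ∀ x, ‖x‖ = ρ → F x = x) : False := by
  have hFd : ∀ x, HasFDerivAt F (fderiv ℝ F x) x := fun x ↦
    (hF.differentiable one_ne_zero x).hasFDerivAt
  have hF'c : Continuous (fderiv ℝ F) := hF.continuous_fderiv one_ne_zero
  let W : E → E →L[ℝ] E := fun x ↦ fderiv ℝ F x - 1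
  have hWc : Continuous W := hF'c.sub continuous_const
  obtain ⟨C, hC⟩ := (isCompact_closedBall (0 : E) ρ).exists_bound_of_continuousOn hWc.continuousOn
  -- The added `1` gives `1 ≤ L`, which handles the centre, where no radial projection exists.
  let L : NNReal := C.toNNReal + 1
  have hL : ∀ x ∈ closedBall (0 : E) ρ, ‖W x‖ ≤ L := fun x hx ↦ by
    have := hC x hx
    have := Real.le_coe_toNNReal C
    push_cast [L]; linarith
  let w : E → E := fun x ↦ if ‖x‖ ≤ ρ then F x - x else 0
  have hlip0 : LipschitzOnWith L (fun x ↦ F x - x) (closedBall 0 ρ) := by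
    refine (convex_closedBall (0 : E) ρ).lipschitzOnWith_of_nnnorm_hasFDerivWithin_le
      (f' := W) (fun x _ ↦ ((hFd x).sub (hasFDerivAt_id x)).hasFDerivWithinAt) fun x hx ↦ ?_
    exact_mod_cast hL x hx
  have key : ∀ x y, ‖x‖ ≤ ρ → ρ < ‖y‖ → ‖F x - x‖ ≤ L * ‖x - y‖ := by
    intro x y hx hy
    have hxy : ‖y‖ - ‖x‖ ≤ ‖x - y‖ := by rw [norm_sub_rev]; exact norm_sub_norm_le y x
    rcases eq_or_ne x 0 with rfl | hx0
    · have : (1 : ℝ) ≤ L := by push_cast [L]; linarith [C.toNNReal.coe_nonneg]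
      simp only [sub_zero, hnorm, zero_sub, norm_neg]
      nlinarith
    · have hxp : 0 < ‖x‖ := norm_pos_iff.2 hx0
      let z := (ρ / ‖x‖) • x
      have hz : ‖z‖ = ρ := by
        simp only [z, norm_smul, norm_div, Real.norm_eq_abs, abs_norm, abs_of_pos hρ]
        field_simp
      have h1 := hlip0.norm_sub_le (x := x) (y := z) (by simpa using hx) (by simp [hz])
      simp only [hid z hz, sub_self, sub_zero] at h1
      have h2 : ‖x - z‖ = ρ - ‖x‖ := by
        have : x - z = -((ρ / ‖x‖ - 1) • x) := by simp [z, sub_smul]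
        rw [this, norm_neg, norm_smul, Real.norm_of_nonneg]
        · field_simp
        · rw [sub_nonneg, le_div_iff₀ hxp]; linarith
      rw [h2] at h1
      exact h1.trans (mul_le_mul_of_nonneg_left (by linarith) L.coe_nonneg)
  have hlip : LipschitzWith L w := by
    refine LipschitzWith.of_dist_le_mul fun x y ↦ ?_
    rw [dist_eq_norm, dist_eq_norm]
    by_cases hx : ‖x‖ ≤ ρ <;> by_cases hy : ‖y‖ ≤ ρ
    · simp only [w, hx, hy, if_true]
      exact hlip0.norm_sub_le (by simpa using hx) (by simpa using hy)
    · simp only [w, hx, hy, if_true, if_false, sub_zero]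
      exact key x y hx (not_le.1 hy)
    · simp only [w, hx, hy, if_true, if_false, zero_sub, norm_neg]
      rw [norm_sub_rev x y]
      exact key y x hy (not_le.1 hx)
    · simp only [w, hx, hy, if_false, sub_zero, norm_zero]
      positivity
  have hw0 : ∀ x, x ∉ ball (0 : E) ρ → w x = 0 := by
    intro x hx
    simp only [mem_ball_zero_iff, not_lt] at hx
    by_cases h : ‖x‖ ≤ ρ
    · simp [w, h, hid x (le_antisymm h hx)]
    · simp [w, h]
  obtain ⟨δ, hδ, hdet⟩ : ∃ δ > 0, ∀ A : E →L[ℝ] E, ‖A - 1‖ < δ → 0 < A.det := by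
    have h1 : ∀ᶠ A : E →L[ℝ] E in nhds 1, 0 < A.det :=
      ContinuousLinearMap.continuous_det.continuousAt.eventually_const_lt
        (by simp [ContinuousLinearMap.det])
    obtain ⟨δ, hδ, h⟩ := Metric.eventually_nhds_iff.1 h1
    exact ⟨δ, hδ, fun A hA ↦ h (by rwa [dist_eq_norm])⟩
  have hLpos : (0 : ℝ) < L := by push_cast [L]; linarith [C.toNNReal.coe_nonneg]
  let v₀ := volume.real (ball (0 : E) ρ)
  -- For small `t` the map `x + t • w x` is a bijection of `E` fixing the complement of the ball,
  -- hence permutes the ball; the integral of its positive Jacobian is the volume.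
  have hsmall : ∀ t : ℝ, 0 ≤ t → t * L < 1 → t * L < δ →
      ∫ x in ball (0 : E) ρ, (1 + t • W x).det = v₀ := by
    intro t ht ht1 htδ
    let g : E → E := fun x ↦ x + t • w x
    have happ : ApproximatesLinearOn g ((ContinuousLinearEquiv.refl ℝ E : E ≃L[ℝ] E) : E →L[ℝ] E)
        univ (t.toNNReal * L) := by
      intro x _ y _
      have : g x - g y - (x - y) = t • (w x - w y) := by simp only [g, smul_sub]; abel
      simp only [ContinuousLinearEquiv.coe_coe, ContinuousLinearEquiv.refl_apply, this, norm_smul,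
        NNReal.coe_mul, Real.coe_toNNReal t ht, Real.norm_of_nonneg ht, mul_assoc]
      exact mul_le_mul_of_nonneg_left (hlip.norm_sub_le x y) ht
    have hc : Subsingleton E ∨ t.toNNReal * L <
        ‖((ContinuousLinearEquiv.refl ℝ E).symm : E →L[ℝ] E)‖₊⁻¹ := by
      rcases subsingleton_or_nontrivial E with h | h
      · exact Or.inl h
      · right
        have : ‖((ContinuousLinearEquiv.refl ℝ E).symm : E →L[ℝ] E)‖₊ = 1 :=
          NNReal.eq (ContinuousLinearMap.norm_id (𝕜 := ℝ) (E := E))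
        rw [this, inv_one, ← NNReal.coe_lt_coe]
        simpa [Real.coe_toNNReal t ht] using ht1
    have hinj : Function.Injective g := injOn_univ.1 (happ.injOn hc)
    have hsurj : Function.Surjective g := happ.surjective hc
    have himg : g '' ball 0 ρ = ball 0 ρ := by
      have h1 : g '' (ball 0 ρ)ᶜ = (ball 0 ρ)ᶜ := by
        have : EqOn g id (ball 0 ρ)ᶜ := fun x hx ↦ by simp [g, hw0 x hx]
        rw [this.image_eq, image_id]
      rwa [image_compl_eq ⟨hinj, hsurj⟩, compl_inj_iff] at h1
    have hder : ∀ x ∈ ball (0 : E) ρ, HasFDerivWithinAt g (1 + t • W x) (ball 0 ρ) x := by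
      intro x hx
      have h1 : HasFDerivWithinAt (fun x ↦ x + t • (F x - x)) (1 + t • W x) (ball 0 ρ) x :=
        ((hasFDerivAt_id x).add (((hFd x).sub (hasFDerivAt_id x)).const_smul t)).hasFDerivWithinAt
      have h2 : ∀ y ∈ ball (0 : E) ρ, g y = y + t • (F y - y) := fun y hy ↦ by
        have : ‖y‖ ≤ ρ := (mem_ball_zero_iff.1 hy).le
        simp [g, w, this]
      exact h1.congr h2 (h2 x hx)
    have h := integral_image_eq_integral_abs_det_fderiv_smul volume measurableSet_ball hder
      hinj.injOn (fun _ ↦ (1 : ℝ))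
    rw [himg] at h
    simp only [integral_const, MeasurableSet.univ, measureReal_restrict_apply, univ_inter,
      smul_eq_mul, mul_one] at h
    rw [show v₀ = _ from h]
    refine setIntegral_congr_fun measurableSet_ball fun x hx ↦ ?_
    refine (abs_of_pos (hdet _ ?_)).symm
    rw [add_sub_cancel_left, norm_smul, Real.norm_of_nonneg ht]
    exact (mul_le_mul_of_nonneg_left (hL x (ball_subset_closedBall hx)) ht).trans_lt htδ
  let n := Module.finrank ℝ E
  obtain ⟨τ, hτ, hτ1, hτδ⟩ : ∃ τ : ℝ, 0 < τ ∧ τ * L < 1 ∧ τ * L < δ := by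
    refine ⟨min 1 δ / 2 / L, by positivity, ?_, ?_⟩ <;>
    · rw [div_mul_cancel₀ _ hLpos.ne']
      have := min_le_left 1 δ
      have := min_le_right 1 δ
      have : 0 < min 1 δ := by positivity
      linarith
  let s : Fin (n + 1) → ℝ := fun i ↦ τ * ((i : ℕ) / (n + 1 : ℝ))
  have hs0 : ∀ i, 0 ≤ s i := fun i ↦ by positivity
  have hsτ : ∀ i, s i ≤ τ := fun i ↦ by
    refine mul_le_of_le_one_right hτ.le ?_
    rw [div_le_one (by positivity)]
    exact_mod_cast i.2.le
  have hsinj : Function.Injective s := by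
    intro i j hij
    have h1 := mul_left_cancel₀ hτ.ne' hij
    have h2 : (n + 1 : ℝ) ≠ 0 := by positivity
    rw [div_left_inj' h2] at h1
    exact Fin.ext (by exact_mod_cast h1)
  -- The determinant has degree at most `n` in `t`, so `n + 1` small nodes determine it at `t = 1`,
  -- where the Jacobian is that of `F`.
  obtain ⟨c, hc⟩ := Polynomial.exists_eval_eq_sum_mul_eval n s hsinj 1
  have hsum : ∑ i, c i = 1 := by simpa using (hc 1 (by simp)).symm
  have hdet1 : ∀ x, (1 + (1 : ℝ) • W x).det = ∑ i, c i * (1 + s i • W x).det := by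
    intro x
    obtain ⟨p, hp, hpe⟩ := (W x).exists_polynomial_eval_eq_det_one_add_smul
    simpa [hpe] using hc p hp
  have hint : ∀ t : ℝ, IntegrableOn (fun x ↦ (1 + t • W x).det) (ball (0 : E) ρ) := fun t ↦ by
    have h : Continuous fun x ↦ (1 + t • W x).det :=
      ContinuousLinearMap.continuous_det.comp (continuous_const.add (hWc.const_smul t))
    exact (h.continuousOn.integrableOn_compact (isCompact_closedBall 0 ρ)).mono_set
      ball_subset_closedBall
  have hI1 : ∫ x in ball (0 : E) ρ, (1 + (1 : ℝ) • W x).det = v₀ := by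
    simp_rw [hdet1]
    rw [integral_finsetSum _ fun i _ ↦ (hint (s i)).const_mul (c i)]
    simp_rw [integral_const_mul]
    rw [Finset.sum_congr rfl fun i _ ↦ by
      rw [hsmall (s i) (hs0 i) ((mul_le_mul_of_nonneg_right (hsτ i) hLpos.le).trans_lt hτ1)
        ((mul_le_mul_of_nonneg_right (hsτ i) hLpos.le).trans_lt hτδ)]]
    rw [← Finset.sum_mul, hsum, one_mul]
  have hzero : ∀ x, (1 + (1 : ℝ) • W x).det = 0 := by
    intro x
    have hW : 1 + (1 : ℝ) • W x = fderiv ℝ F x := by simp [W]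
    rw [hW]
    by_contra hne
    -- Since `‖F‖` is constant, the derivative has range orthogonal to `F x ≠ 0`, so it cannot be
    -- surjective.
    have horth : ∀ u, inner ℝ (F x) (fderiv ℝ F x u) = 0 := by
      intro u
      have h1 : HasFDerivAt (fun y ↦ inner ℝ (F y) (F y)) _ x := (hFd x).inner ℝ (hFd x)
      have h2 : (fun y ↦ inner ℝ (F y) (F y)) = fun _ ↦ ρ ^ 2 := by
        ext y; rw [real_inner_self_eq_norm_sq, hnorm]
      rw [h2] at h1
      have h3 := congr($(h1.unique (hasFDerivAt_const _ _)) u)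
      simp [real_inner_comm] at h3
      linarith [real_inner_comm (F x) (fderiv ℝ F x u)]
    obtain ⟨u, hu⟩ : ∃ u, fderiv ℝ F x u = F x :=
      (LinearMap.equivOfDetNeZero _ hne).surjective (F x)
    have h4 := horth u
    rw [hu, real_inner_self_eq_norm_sq, hnorm] at h4
    have : 0 < ρ ^ 2 := by positivity
    linarith
  simp only [hzero, integral_zero] at hI1
  have : 0 < v₀ := ENNReal.toReal_pos (measure_ball_pos volume 0 hρ).ne' measure_ball_lt_top.ne
  linarith

/-- Brouwer's fixed point theorem for bounded `C¹` maps. -/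
theorem ContDiff.exists_fixed_point_of_bounded {E : Type*} [NormedAddCommGroup E]
    [InnerProductSpace ℝ E] [FiniteDimensional ℝ E] {G : E → E} (hG : ContDiff ℝ 1 G) {R : ℝ}
    (hR : ∀ x, ‖G x‖ ≤ R) : ∃ x, G x = x := by
  by_contra! hfix
  borelize E
  have hR0 : 0 ≤ R := (norm_nonneg _).trans (hR 0)
  -- The cutoff makes `v` the identity on the sphere of radius `R + 2`; normalising `v` would give a
  -- retraction.
  let χ : ContDiffBump (0 : E) := ⟨R + 1, R + 2, by linarith, by linarith⟩
  let v : E → E := fun x ↦ x - χ x • G x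
  have hv : ContDiff ℝ 1 v := contDiff_id.sub (χ.contDiff.smul hG)
  have hv0 : ∀ x, v x ≠ 0 := by
    intro x hx
    rw [sub_eq_zero] at hx
    rcases le_or_gt ‖x‖ (R + 1) with h | h
    · rw [χ.one_of_mem_closedBall (by simpa using h), one_smul] at hx
      exact hfix x hx.symm
    · have h1 : ‖x‖ ≤ R := by
        rw [hx, norm_smul, Real.norm_of_nonneg χ.nonneg]
        exact (mul_le_of_le_one_left (norm_nonneg _) χ.le_one).trans (hR x)
      linarith
  have hρ : 0 < R + 2 := by linarith
  refine not_exists_contDiff_retraction_sphere (F := fun x ↦ ((R + 2) * ‖v x‖⁻¹) • v x)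
    ((contDiff_const.mul ((hv.norm ℝ hv0).inv fun x ↦ norm_ne_zero_iff.2 (hv0 x))).smul hv) hρ
    (fun x ↦ ?_) (fun x hx ↦ ?_)
  · have := norm_ne_zero_iff.2 (hv0 x)
    rw [norm_smul, norm_mul, norm_inv, norm_norm, Real.norm_of_nonneg hρ.le]
    field_simp
  · have : v x = x := by
      simp only [v, χ.zero_of_le_dist (x := x) (by simp [hx, χ]), zero_smul, sub_zero]
    rw [this, hx, mul_inv_cancel₀ hρ.ne', one_smul]

/-- Brouwer's fixed point theorem for bounded continuous maps. -/
theorem Continuous.exists_fixed_point_of_bounded {E : Type*} [NormedAddCommGroup E]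
    [InnerProductSpace ℝ E] [FiniteDimensional ℝ E] {G : E → E} (hG : Continuous G) {R : ℝ}
    (hR : ∀ x, ‖G x‖ ≤ R) : ∃ x, G x = x := by
  have happrox : ∀ ε > 0, ∃ x, dist x (G x) < ε := by
    intro ε hε
    obtain ⟨g, hg, hgG, -⟩ := hG.exists_contDiff_approx 1 (continuous_const (y := ε)) fun _ ↦ hε
    obtain ⟨x, hx⟩ := ContDiff.exists_fixed_point_of_bounded (R := ε + R) (by exact_mod_cast hg)
      fun x ↦ by
        have h1 := norm_le_norm_sub_add (g x) (G x)
        have h2 := hgG x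
        rw [dist_eq_norm] at h2
        linarith [hR x]
    exact ⟨x, by simpa [hx] using hgG x⟩
  have hK : IsCompact (Metric.closedBall (0 : E) (R + 1)) := isCompact_closedBall _ _
  obtain ⟨x, hx, hmin⟩ := hK.exists_isMinOn
    ⟨0, by simpa using (norm_nonneg _).trans ((hR 0).trans (by linarith))⟩
    (continuous_id.dist hG).continuousOn
  refine ⟨x, ?_⟩
  by_contra hne
  have hpos : 0 < dist x (G x) := dist_pos.2 (Ne.symm hne)
  -- The bound `1` keeps `y` in the compact ball; the other one contradicts minimality at `x`.
  obtain ⟨y, hy⟩ := happrox (min 1 (dist x (G x))) (by positivity)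
  have hy1 := hy.trans_le (min_le_left _ _)
  have hyK : y ∈ Metric.closedBall (0 : E) (R + 1) := by
    rw [mem_closedBall_zero_iff]
    rw [dist_eq_norm] at hy1
    linarith [norm_le_norm_sub_add y (G y), hR y]
  have := hmin hyK
  simp only [id] at this
  exact absurd (hy.trans_le (min_le_right _ _)) (not_lt.2 this)

/-! ### Schauder's fixed point theorem -/

theorem Finset.sum_div_smul_mem_closedBall {Y ι : Type*} [NormedAddCommGroup Y] [NormedSpace ℝ Y]
    {s : Finset ι} {a : ι → ℝ} {z : ι → Y} {c : Y} {r : ℝ} (ha : ∀ i ∈ s, 0 ≤ a i)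
    (hs : 0 < ∑ i ∈ s, a i) (hz : ∀ i ∈ s, a i ≠ 0 → dist (z i) c ≤ r) :
    ∑ i ∈ s, (a i / ∑ j ∈ s, a j) • z i ∈ Metric.closedBall c r := by
  have h1 : ∑ i ∈ s, a i / ∑ j ∈ s, a j = 1 := by rw [← Finset.sum_div, div_self hs.ne']
  have h2 : ∑ i ∈ s, (a i / ∑ j ∈ s, a j) • z i - c =
      ∑ i ∈ s, (a i / ∑ j ∈ s, a j) • (z i - c) := by
    simp_rw [smul_sub]
    rw [Finset.sum_sub_distrib, ← Finset.sum_smul, h1, one_smul]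
  rw [mem_closedBall_iff_norm, h2]
  calc _ ≤ ∑ i ∈ s, (a i / ∑ j ∈ s, a j) * r := by
        refine norm_sum_le_of_le s fun i hi ↦ ?_
        rw [norm_smul, Real.norm_of_nonneg (div_nonneg (ha i hi) hs.le)]
        rcases eq_or_ne (a i) 0 with h | h
        · simp [h]
        · rw [← dist_eq_norm]
          exact mul_le_mul_of_nonneg_left (hz i hi h) (div_nonneg (ha i hi) hs.le)
    _ = r := by rw [← Finset.sum_mul, h1, one_mul]

/-- Schauder's fixed point theorem: a continuous self-map of a normed space with relatively compact
range has a fixed point. -/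
theorem IsCompact.exists_fixed_point_of_continuous {Y : Type*} [NormedAddCommGroup Y]
    [NormedSpace ℝ Y] {K : Set Y} (hK : IsCompact K) {g : Y → Y} (hg : Continuous g)
    (hgK : ∀ x, g x ∈ K) : ∃ x, g x = x := by
  have happrox : ∀ ε > 0, ∃ x, dist x (g x) ≤ ε := by
    intro ε hε
    obtain ⟨s, -, hs, hKs⟩ := hK.finite_cover_balls hε
    have := hs.fintype
    let μ : s → Y → ℝ := fun j y ↦ max 0 (ε - dist y j)
    have hμ0 : ∀ j y, 0 ≤ μ j y := fun j y ↦ le_max_left _ _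
    let S : Y → ℝ := fun y ↦ ∑ j, μ j y
    have hS : ∀ y ∈ K, 0 < S y := by
      intro y hy
      obtain ⟨j, hj, hyj⟩ := Set.mem_iUnion₂.1 (hKs hy)
      exact Finset.sum_pos' (fun j _ ↦ hμ0 j y)
        ⟨⟨j, hj⟩, Finset.mem_univ _, lt_max_of_lt_right (sub_pos.2 hyj)⟩
    have hμc : ∀ j, Continuous (μ j) := fun j ↦ by fun_prop
    have hSc : Continuous S := by fun_prop
    let ι : EuclideanSpace ℝ s → Y := fun t ↦ ∑ j, t j • (j : Y)
    have hι : Continuous ι := by fun_prop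
    -- The Schauder projection of `g`, read on coefficient vectors; a fixed `t` gives a point `ι t`
    -- within `ε` of its image.
    let G : EuclideanSpace ℝ s → EuclideanSpace ℝ s :=
      fun t ↦ WithLp.toLp 2 fun j ↦ μ j (g (ι t)) / S (g (ι t))
    have hG : Continuous G := by
      refine (PiLp.continuous_toLp 2 _).comp (continuous_pi fun j ↦ ?_)
      exact ((hμc j).comp (hg.comp hι)).div (hSc.comp (hg.comp hι)) fun t ↦ (hS _ (hgK _)).ne'
    have hGb : ∀ t, ‖G t‖ ≤ √(Fintype.card s) := by
      intro t
      rw [EuclideanSpace.norm_eq]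
      refine Real.sqrt_le_sqrt ?_
      refine (Finset.sum_le_card_nsmul Finset.univ _ 1 fun j _ ↦ ?_).trans (by simp)
      have hp := hS _ (hgK (ι t))
      have h1 : 0 ≤ μ j (g (ι t)) / S (g (ι t)) := div_nonneg (hμ0 _ _) hp.le
      have h2 : μ j (g (ι t)) / S (g (ι t)) ≤ 1 := by
        rw [div_le_one hp]
        exact Finset.single_le_sum (f := fun j ↦ μ j (g (ι t))) (fun j _ ↦ hμ0 j _)
          (Finset.mem_univ j)
      rw [Real.norm_of_nonneg h1]
      exact pow_le_one₀ h1 h2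
    obtain ⟨t, ht⟩ := hG.exists_fixed_point_of_bounded hGb
    refine ⟨ι t, ?_⟩
    set y := g (ι t)
    have hp : 0 < S y := hS _ (hgK _)
    have htj : ∀ j, t j = μ j y / S y := fun j ↦ congr($ht j).symm
    have hmem : ∑ j, (μ j y / S y) • (j : Y) ∈ Metric.closedBall y ε := by
      refine Finset.sum_div_smul_mem_closedBall (fun j _ ↦ hμ0 j y) hp fun j _ hj ↦ ?_
      by_contra hfar
      refine hj (max_eq_left ?_)
      rw [dist_comm y]
      linarith
    simpa only [ι, htj, Metric.mem_closedBall] using hmem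
  choose x hx using fun n : ℕ ↦ happrox (1 / ((n : ℝ) + 1)) (by positivity)
  obtain ⟨y, -, φ, hφ, hy⟩ := hK.tendsto_subseq fun n ↦ hgK (x n)
  have hd : Filter.Tendsto (fun n ↦ dist (x (φ n)) (g (x (φ n)))) Filter.atTop (nhds 0) :=
    squeeze_zero (fun _ ↦ dist_nonneg) (fun n ↦ hx (φ n))
      (tendsto_one_div_add_atTop_nhds_zero_nat.comp hφ.tendsto_atTop)
  have hxy : Filter.Tendsto (x ∘ φ) Filter.atTop (nhds y) := hy.congr_dist (by
    simpa only [Function.comp_def, dist_comm] using hd)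
  exact ⟨y, tendsto_nhds_unique ((hg.tendsto y).comp hxy) hy⟩

/-! ### Invariant subspaces and Lomonosov's argument -/

theorem ContinuousLinearMap.ker_sub_smul_id_ne_top {Y : Type*} [NormedAddCommGroup Y]
    [NormedSpace ℂ Y] {h : Y →L[ℂ] Y} {c : ℂ} (hc : h ≠ c • ContinuousLinearMap.id ℂ Y) :
    (h - c • ContinuousLinearMap.id ℂ Y).ker ≠ ⊤ := by
  intro htop
  refine hc (ContinuousLinearMap.ext fun x ↦ ?_)
  have : x ∈ (h - c • ContinuousLinearMap.id ℂ Y).ker := htop ▸ Submodule.mem_top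
  simpa [sub_eq_zero] using this

/-- A non-scalar operator leaving a nonzero finite-dimensional subspace invariant has an
eigenspace, which is invariant under its commutant. -/
theorem ContinuousLinearMap.exists_invariant_of_finiteDimensional {Y : Type*}
    [NormedAddCommGroup Y] [NormedSpace ℂ Y] {f h : Y →L[ℂ] Y}
    (hscalar : ∀ c : ℂ, h ≠ c • ContinuousLinearMap.id ℂ Y) (hfh : f ∘L h = h ∘L f)
    (N : Submodule ℂ Y) [FiniteDimensional ℂ N] (hN : N ≠ ⊥) (hhN : ∀ x ∈ N, h x ∈ N) :
    ∃ M : Submodule ℂ Y,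
      M ≠ ⊥ ∧ M ≠ ⊤ ∧ IsClosed (M : Set Y) ∧ ∀ x ∈ M, f x ∈ M := by
  have : Nontrivial N := Submodule.nontrivial_iff_ne_bot.2 hN
  obtain ⟨c, hc⟩ := Module.End.exists_eigenvalue ((h : Y →ₗ[ℂ] Y).restrict hhN)
  obtain ⟨v, hv⟩ := hc.exists_hasEigenvector
  have hvc : h v = c • (v : Y) := by simpa using congr(($hv.apply_eq_smul : Y))
  refine ⟨(h - c • ContinuousLinearMap.id ℂ Y).ker, fun hbot ↦ ?_,
    ContinuousLinearMap.ker_sub_smul_id_ne_top (hscalar c),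
    ContinuousLinearMap.isClosed_ker _, fun x hx ↦ ?_⟩
  · have h1 : (v : Y) ∈ (h - c • ContinuousLinearMap.id ℂ Y).ker := by simp [hvc]
    rw [hbot, Submodule.mem_bot] at h1
    exact hv.2 (Subtype.ext h1)
  · have h1 : h x = c • x := by simpa [sub_eq_zero] using hx
    have h2 : f (h x) = h (f x) := congr($hfh x)
    simp [← h2, h1]

/-- On its fixed space `S` restricts to the identity, which is then compact; Riesz's theorem
applies. -/
theorem IsCompactOperator.finiteDimensional_ker_sub_id {Y : Type*} [NormedAddCommGroup Y]
    [NormedSpace ℂ Y] {S : Y →L[ℂ] Y} (hS : IsCompactOperator S) :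
    FiniteDimensional ℂ (S - ContinuousLinearMap.id ℂ Y).ker := by
  set E := (S - ContinuousLinearMap.id ℂ Y).ker
  have hE : ∀ x ∈ E, S x = x := fun x hx ↦ by simpa [E, sub_eq_zero] using hx
  have hES : ∀ x ∈ E, (S : Y →ₗ[ℂ] Y) x ∈ E := fun x hx ↦ by simpa [hE x hx] using hx
  have hr := IsCompactOperator.restrict (f := (S : Y →ₗ[ℂ] Y)) hS (V := E) hES
    (ContinuousLinearMap.isClosed_ker _)
  refine (isCompactOperator_id_iff_finiteDimensional (𝕜 := ℂ)).1 ?_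
  have hid : (id : E → E) = (S : Y →ₗ[ℂ] Y).restrict hES := by
    ext x
    simp [hE x x.2]
  rw [hid]
  exact hr

/-- Lomonosov's lemma: if the nonzero vectors are cyclic for a subspace `A` of operators, then some
member of `A` composed with a given nonzero compact operator has a nonzero fixed vector. -/
theorem IsCompactOperator.exists_fixed_vector {Y : Type*} [NormedAddCommGroup Y]
    [NormedSpace ℂ Y] {k : Y →L[ℂ] Y} (hk : IsCompactOperator k) (hk0 : k ≠ 0)
    (A : Submodule ℂ (Y →L[ℂ] Y)) (hA : ∀ y ≠ 0, Dense {z | ∃ T ∈ A, T y = z}) :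
    ∃ T ∈ A, ∃ x ≠ 0, T (k x) = x := by
  obtain ⟨x₀, hx₀⟩ : ∃ x, k x ≠ 0 := by
    by_contra! h
    exact hk0 (ContinuousLinearMap.ext h)
  obtain ⟨r, hr, hball⟩ : ∃ r > 0, ∀ x ∈ Metric.closedBall x₀ r, ‖k x₀‖ / 2 ≤ ‖k x‖ := by
    have h1 : ∀ᶠ x in nhds x₀, ‖k x₀‖ / 2 < ‖k x‖ :=
      k.continuous.norm.continuousAt.eventually_const_lt (half_lt_self (norm_pos_iff.2 hx₀))
    obtain ⟨r, hr, h⟩ := Metric.nhds_basis_closedBall.eventually_iff.1 h1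
    exact ⟨r, hr, fun x hx ↦ (h hx).le⟩
  have hpos : 0 < ‖k x₀‖ / 2 := half_pos (norm_pos_iff.2 hx₀)
  let B := Metric.closedBall x₀ r
  let K := closure (k '' B)
  have hK : IsCompact K :=
    hk.isCompact_closure_image_of_bounded (f := (k : Y →ₗ[ℂ] Y)) Metric.isBounded_closedBall
  have hK0 : ∀ y ∈ K, y ≠ 0 := by
    have h1 : K ⊆ {y | ‖k x₀‖ / 2 ≤ ‖y‖} :=
      closure_minimal (by rintro _ ⟨x, hx, rfl⟩; exact hball x hx)
        (isClosed_le continuous_const continuous_norm)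
    rintro y hy rfl
    have := h1 hy
    simp only [Set.mem_ofPred_eq, norm_zero] at this
    linarith
  obtain ⟨s, hs⟩ := hK.elim_finite_subcover (fun T : A ↦ (T : Y →L[ℂ] Y) ⁻¹' Metric.ball x₀ r)
    (fun T ↦ Metric.isOpen_ball.preimage (T : Y →L[ℂ] Y).continuous) (fun y hy ↦ by
      obtain ⟨_, ⟨T, hT, rfl⟩, hz⟩ := (hA y (hK0 y hy)).exists_mem_open Metric.isOpen_ball
        ⟨x₀, Metric.mem_ball_self hr⟩
      exact Set.mem_iUnion.2 ⟨⟨T, hT⟩, hz⟩)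
  let α : A → Y → ℝ := fun T y ↦ max 0 (r - dist ((T : Y →L[ℂ] Y) y) x₀)
  have hα0 : ∀ T y, 0 ≤ α T y := fun _ _ ↦ le_max_left _ _
  have hαc : ∀ T, Continuous (α T) := fun T ↦ by fun_prop
  let S : Y → ℝ := fun y ↦ ∑ T ∈ s, α T y
  have hSc : Continuous S := by fun_prop
  have hS : ∀ y ∈ K, 0 < S y := by
    intro y hy
    obtain ⟨T, hT, hTy⟩ := Set.mem_iUnion₂.1 (hs hy)
    exact Finset.sum_pos' (fun j _ ↦ hα0 j y) ⟨T, hT, lt_max_of_lt_right (sub_pos.2 hTy)⟩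
  let Φ : Y → Y := fun y ↦ ∑ T ∈ s, (α T y / S y) • (T : Y →L[ℂ] Y) y
  have hΦ : ContinuousOn Φ K := by
    refine continuousOn_finsetSum s fun T _ ↦ ?_
    have h1 : ContinuousOn (fun y ↦ α T y / S y) K :=
      (hαc T).continuousOn.div hSc.continuousOn fun y hy ↦ (hS y hy).ne'
    exact h1.smul (T : Y →L[ℂ] Y).continuous.continuousOn
  have hΦB : ∀ y ∈ K, Φ y ∈ B := fun y hy ↦ by
    refine Finset.sum_div_smul_mem_closedBall (fun T _ ↦ hα0 T y) (hS y hy) fun T _ hT ↦ ?_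
    by_contra hfar
    exact hT (max_eq_left (by linarith))
  -- Radial retraction onto `B`, making `Φ ∘ k` a map of all of `Y`; its fixed points lie in `B`,
  -- hence are not `0`.
  let π : Y → Y := fun x ↦ x₀ + (r / max r ‖x - x₀‖) • (x - x₀)
  have hmax : ∀ x, 0 < max r ‖x - x₀‖ := fun x ↦ lt_max_of_lt_left hr
  have hπc : Continuous π := continuous_const.add ((continuous_const.div (by fun_prop)
    fun x ↦ (hmax x).ne').smul (by fun_prop))
  have hπB : ∀ x, π x ∈ B := fun x ↦ by
    rw [mem_closedBall_iff_norm]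
    simp only [π, add_sub_cancel_left]
    rw [norm_smul, Real.norm_of_nonneg (div_nonneg hr.le (hmax x).le), div_mul_eq_mul_div,
      div_le_iff₀ (hmax x)]
    exact mul_le_mul_of_nonneg_left (le_max_right _ _) hr.le
  have hπid : ∀ x ∈ B, π x = x := fun x hx ↦ by
    rw [mem_closedBall_iff_norm] at hx
    simp [π, max_eq_left hx, hr.ne']
  have hkK : ∀ x, k (π x) ∈ K := fun x ↦ subset_closure ⟨π x, hπB x, rfl⟩
  obtain ⟨x, hx⟩ := (hK.image_of_continuousOn hΦ).exists_fixed_point_of_continuous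
    (g := fun x ↦ Φ (k (π x))) (hΦ.comp_continuous (k.continuous.comp hπc) hkK)
    fun x ↦ ⟨_, hkK x, rfl⟩
  have hxB : x ∈ B := hx ▸ hΦB _ (hkK x)
  simp only [hπid x hxB] at hx
  -- Freezing the weights at the fixed point turns the nonlinear `Φ` into a member of `A`.
  refine ⟨∑ T ∈ s, ((α T (k x) / S (k x) : ℝ) : ℂ) • (T : Y →L[ℂ] Y),
    A.sum_mem fun T _ ↦ A.smul_mem _ T.2, x, ?_, ?_⟩
  · rintro rfl
    have := hball 0 hxB
    simp only [map_zero, norm_zero] at this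
    linarith
  · conv_rhs => rw [← hx]
    simp only [Φ, sum_apply, smul_apply, Complex.coe_smul]

/-- Lomonosov's theorem on a normed space: an operator commuting with a non-scalar operator that
commutes with a nonzero compact operator has a nontrivial closed invariant subspace. -/
theorem IsCompactOperator.exists_invariant_of_commute {Y : Type*} [NormedAddCommGroup Y]
    [NormedSpace ℂ Y] {f h k : Y →L[ℂ] Y}
    (hscalar : ∀ c : ℂ, h ≠ c • ContinuousLinearMap.id ℂ Y) (hk : IsCompactOperator k)
    (hk0 : k ≠ 0) (hfh : f ∘L h = h ∘L f) (hhk : h ∘L k = k ∘L h) :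
    ∃ M : Submodule ℂ Y,
      M ≠ ⊥ ∧ M ≠ ⊤ ∧ IsClosed (M : Set Y) ∧ ∀ x ∈ M, f x ∈ M := by
  by_contra! hno
  let C := Subalgebra.centralizer ℂ {h}
  have hC : ∀ {T}, T ∈ C ↔ h * T = T * h := by
    intro T
    simp [C, Subalgebra.mem_centralizer_iff]
  have hfC : f ∈ C := hC.2 hfh.symm
  have hdense : ∀ y ≠ 0, Dense {z | ∃ T ∈ Subalgebra.toSubmodule C, T y = z} := by
    intro y hy
    let P : Submodule ℂ Y :=
      (Subalgebra.toSubmodule C).map (ContinuousLinearMap.apply ℂ Y y : (Y →L[ℂ] Y) →ₗ[ℂ] Y)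
    have hyP : y ∈ P := ⟨1, C.one_mem, rfl⟩
    have hfP : ∀ x ∈ P, f x ∈ P := by
      rintro _ ⟨T, hT, rfl⟩
      exact ⟨f * T, C.mul_mem hfC hT, rfl⟩
    have htop : P.topologicalClosure = ⊤ := by
      by_contra hne
      obtain ⟨x, hx, hfx⟩ := hno P.topologicalClosure
        (fun hbot ↦ hy ((Submodule.mem_bot ℂ).1 (hbot ▸ P.le_topologicalClosure hyP))) hne
        P.isClosed_topologicalClosure
      exact hfx (map_mem_closure f.continuous hx hfP)
    exact Submodule.dense_iff_topologicalClosure_eq_top.2 htop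
  obtain ⟨T, hT, x, hx, hTx⟩ := hk.exists_fixed_vector hk0 _ hdense
  have hTh : ∀ y, h (T y) = T (h y) := fun y ↦ congr($(hC.1 hT) y)
  have hkh : ∀ y, h (k y) = k (h y) := fun y ↦ congr($hhk y)
  have := IsCompactOperator.finiteDimensional_ker_sub_id (S := T ∘L k) (hk.clm_comp T)
  obtain ⟨M, h1, h2, h3, h4⟩ := ContinuousLinearMap.exists_invariant_of_finiteDimensional
    hscalar hfh (T ∘L k - ContinuousLinearMap.id ℂ Y).ker
    (fun hbot ↦ hx ((Submodule.mem_bot ℂ).1 (hbot ▸ by simp [hTx])))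
    (fun y hy ↦ by
      have hy' : T (k y) = y := by simpa [sub_eq_zero] using hy
      simp [← hTh, ← hkh, hy'])
  obtain ⟨y, hy, hfy⟩ := hno M h1 h2 h3
  exact hfy (h4 y hy)

theorem mainTheorem4 {Y : Type*} [NormedAddCommGroup Y] [NormedSpace ℂ Y]
    (N : Submodule ℂ Y) (hN : FiniteDimensional ℂ N)
    (f h k : Y →L[ℂ] Y)
    (hscalar : ∀ c : ℂ, h ≠ c • ContinuousLinearMap.id ℂ Y)
    (hk_compact : IsCompactOperator k)
    (hk_ne : k ≠ 0)
    (hfh : f ∘L h = h ∘L f)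
    (hhk : ∀ x : Y, (h ∘L k - k ∘L h) x ∈ N)
    (hhN : ∀ x ∈ N, h x ∈ N) :
    ∃ M : Submodule ℂ Y,
      M ≠ ⊥ ∧ M ≠ ⊤ ∧ IsClosed (M : Set Y) ∧ ∀ x ∈ M, f x ∈ M := by
  rcases eq_or_ne N ⊥ with rfl | hN0
  · refine hk_compact.exists_invariant_of_commute hscalar hk_ne hfh ?_
    ext x
    simpa [sub_eq_zero] using hhk x
  · exact ContinuousLinearMap.exists_invariant_of_finiteDimensional hscalar hfh N hN0 hhN
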